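/- **Aztec diamond theorem.** Let $n\ge 0$ be an integer. The Aztec diamond of order $n$, denoted $\mathrm{Az}(n)\subset\mathbb{R}^2$, is the union of all closed unit squares $[i,i+1]\times[j,j+1]$ ($i,j\in\mathbb{Z}$) all four of whose corners $(x,y)$ satisfy $|x|+|y|\le n+1$. A domino is a closed $1\times 2$ or $2\times 1$ axis-parallel rectangle with integer corners, and a domino tiling of a region $R\subseteq\mathbb{R}^2$ is a set of dominos with pairwise disjoint interiors whose union is $R$. Then the number of domino tilings of $\mathrm{Az}(n)$ is $2^{n(n+1)/2}$. -/

import Mathlib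

namespace Aztec

/-- The closed unit square of the plane whose lower left corner is the lattice point `(i, j)`. -/
def unitSquare (i j : ℤ) : Set (ℝ × ℝ) :=
  Set.Icc (i : ℝ) (i + 1) ×ˢ Set.Icc (j : ℝ) (j + 1)

/-- The Aztec diamond of order `n`: the union of all the unit squares with integral corners
such that each of the four corners `(x, y)` satisfies `|x| + |y| ≤ n + 1`. -/
def aztecDiamond (n : ℕ) : Set (ℝ × ℝ) :=
  ⋃₀ {S | ∃ i j : ℤ, S = unitSquare i j ∧
    ∀ x ∈ ({i, i + 1} : Set ℤ), ∀ y ∈ ({j, j + 1} : Set ℤ), |x| + |y| ≤ (n : ℤ) + 1}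

/-- A domino: a closed 2-by-1 or 1-by-2 rectangle with integral corners. -/
def IsDomino (D : Set (ℝ × ℝ)) : Prop :=
  ∃ i j : ℤ,
    D = Set.Icc (i : ℝ) (i + 2) ×ˢ Set.Icc (j : ℝ) (j + 1) ∨
    D = Set.Icc (i : ℝ) (i + 1) ×ˢ Set.Icc (j : ℝ) (j + 2)

/-- A domino tiling of a region `R`: a set of dominos, no two of which overlap (have a common
interior point), the union of which is `R`. -/
def IsDominoTiling (R : Set (ℝ × ℝ)) (T : Set (Set (ℝ × ℝ))) : Prop :=
  (∀ D ∈ T, IsDomino D) ∧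
  T.Pairwise (fun D E => Disjoint (interior D) (interior E)) ∧
  ⋃₀ T = R

end Aztec

namespace Aztec

/-! ### Lattice dominoes -/

/-! Cut the plane into overlapping 2×2 blocks whose centres have one fixed parity. Every domino lies
in exactly one block, and every cell in exactly two diagonally adjacent ones. The same (n+1)×(n+1)
grid of blocks serves two diamonds: the cells shared by two blocks of the grid form Az(n), and
adding the border cells gives Az(n+1). For each block, record which of its four cells its own
dominoes cover. A shared cell is covered from exactly one side, so complementing all coverages turns
a pattern for Az(n+1) into one for Az(n), and conversely. A coverage has weight 2 if full, 1 if
empty or two adjacent cells, and 0 otherwise. Hence complementation changes weights as in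
`Coverage.two_mul_weight`; multiplying over all blocks shows that Az(n+1) has 2^(n+1) times as many
tilings as Az(n) (`gridCount_true`), and induction finishes. -/

/-- The closed domino with lower left corner `(d.1, d.2.1)`, vertical if and only if `d.2.2`. -/
def domino (d : ℤ × ℤ × Bool) : Set (ℝ × ℝ) :=
  Set.Icc (d.1 : ℝ) (d.1 + cond d.2.2 1 2) ×ˢ Set.Icc (d.2.1 : ℝ) (d.2.1 + cond d.2.2 2 1)

/-- The unit cell with lower left corner `(i, j)` is one of the two cells of the domino. -/
def CellIn (i j : ℤ) (d : ℤ × ℤ × Bool) : Prop :=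
  d.1 ≤ i ∧ i < d.1 + cond d.2.2 1 2 ∧ d.2.1 ≤ j ∧ j < d.2.1 + cond d.2.2 2 1

theorem isDomino_iff {D : Set (ℝ × ℝ)} : IsDomino D ↔ ∃ d, D = domino d := by
  constructor
  · rintro ⟨i, j, h | h⟩
    · exact ⟨(i, j, false), h⟩
    · exact ⟨(i, j, true), h⟩
  · rintro ⟨⟨i, j, _ | _⟩, h⟩
    · exact ⟨i, j, Or.inl h⟩
    · exact ⟨i, j, Or.inr h⟩

theorem cellIn_iff {i j : ℤ} {d : ℤ × ℤ × Bool} :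
    CellIn i j d ↔ d = (i, j, false) ∨ d = (i - 1, j, false) ∨ d = (i, j, true) ∨
      d = (i, j - 1, true) := by
  obtain ⟨k, l, _ | _⟩ := d <;> simp [CellIn] <;> omega

/-- The centre of a unit cell. -/
noncomputable def center (i j : ℤ) : ℝ × ℝ := (i + 1 / 2, j + 1 / 2)

theorem half_int_lt {i k : ℤ} : (i : ℝ) + 1 / 2 < k ↔ i < k := by
  constructor
  · intro h
    have : (i : ℝ) < k := by linarith
    exact_mod_cast this
  · intro h
    have : (i : ℝ) + 1 ≤ k := by exact_mod_cast h
    linarith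

theorem lt_half_int {i k : ℤ} : (k : ℝ) < i + 1 / 2 ↔ k ≤ i := by
  constructor
  · intro h
    have : (k : ℝ) < (i + 1 : ℤ) := by push_cast; linarith
    have : k < i + 1 := by exact_mod_cast this
    omega
  · intro h
    have : (k : ℝ) ≤ i := by exact_mod_cast h
    linarith

theorem half_int_le {i k : ℤ} : (i : ℝ) + 1 / 2 ≤ k ↔ i < k := by
  rw [← not_lt, lt_half_int, not_le]

theorem le_half_int {i k : ℤ} : (k : ℝ) ≤ i + 1 / 2 ↔ k ≤ i := by
  rw [← not_lt, half_int_lt, not_lt]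

theorem interior_domino (d : ℤ × ℤ × Bool) : interior (domino d) =
    Set.Ioo (d.1 : ℝ) (d.1 + cond d.2.2 1 2) ×ˢ Set.Ioo (d.2.1 : ℝ) (d.2.1 + cond d.2.2 2 1) := by
  rw [domino, interior_prod_eq, interior_Icc, interior_Icc]

theorem center_mem_domino {i j : ℤ} {d : ℤ × ℤ × Bool} :
    center i j ∈ domino d ↔ CellIn i j d := by
  have h1 := @half_int_le i (d.1 + cond d.2.2 1 2)
  have h2 := @half_int_le j (d.2.1 + cond d.2.2 2 1)
  obtain ⟨k, l, _ | _⟩ := d <;>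
  · simp only [cond] at h1 h2
    push_cast at h1 h2
    simp only [center, domino, CellIn, Set.mem_prod, Set.mem_Icc, cond, le_half_int, h1, h2]
    tauto

theorem center_mem_interior_domino {i j : ℤ} {d : ℤ × ℤ × Bool} :
    center i j ∈ interior (domino d) ↔ CellIn i j d := by
  have h1 := @half_int_lt i (d.1 + cond d.2.2 1 2)
  have h2 := @half_int_lt j (d.2.1 + cond d.2.2 2 1)
  rw [interior_domino]
  obtain ⟨k, l, _ | _⟩ := d <;>
  · simp only [cond] at h1 h2
    push_cast at h1 h2
    simp only [center, CellIn, Set.mem_prod, Set.mem_Ioo, cond, lt_half_int, h1, h2]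
    tauto

theorem center_mem_unitSquare {i j k l : ℤ} :
    center i j ∈ unitSquare k l ↔ i = k ∧ j = l := by
  have h1 := @half_int_le i (k + 1)
  have h2 := @half_int_le j (l + 1)
  push_cast at h1 h2
  simp only [center, unitSquare, Set.mem_prod, Set.mem_Icc, le_half_int, h1, h2]
  omega

theorem domino_injective : Function.Injective domino := by
  intro d e h
  have key : ∀ i j, CellIn i j d ↔ CellIn i j e := fun i j => by
    rw [← center_mem_domino, h, center_mem_domino]
  obtain ⟨k, l, o⟩ := d
  obtain ⟨k', l', o'⟩ := e
  have h1 := key k l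
  have h2 := key k' l'
  have h3 := key (k + 1) l
  have h4 := key k (l + 1)
  cases o <;> cases o' <;> simp [CellIn] at h1 h2 h3 h4 ⊢ <;> omega

theorem exists_cellIn_of_not_disjoint {d e : ℤ × ℤ × Bool}
    (h : ¬ Disjoint (interior (domino d)) (interior (domino e))) :
    ∃ i j, CellIn i j d ∧ CellIn i j e := by
  obtain ⟨⟨x, y⟩, hd, he⟩ := Set.not_disjoint_iff.1 h
  rw [interior_domino] at hd he
  obtain ⟨⟨a1, a2⟩, a3, a4⟩ := hd
  obtain ⟨⟨b1, b2⟩, b3, b4⟩ := he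
  obtain ⟨k, l, o⟩ := d
  obtain ⟨k', l', o'⟩ := e
  have e1 := a1.trans b2
  have e2 := b1.trans a2
  have e3 := a3.trans b4
  have e4 := b3.trans a4
  -- The overlap is a rectangle with integer corners; this is its lower left corner.
  refine ⟨max k k', max l l', ?_⟩
  cases o <;> cases o' <;>
  · simp only [cond] at e1 e2 e3 e4
    norm_cast at e1 e2 e3 e4
    simp only [CellIn, cond]
    omega

theorem mem_domino_iff {d : ℤ × ℤ × Bool} {p : ℝ × ℝ} :
    p ∈ domino d ↔ ∃ i j, CellIn i j d ∧ p ∈ unitSquare i j := by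
  obtain ⟨x, y⟩ := p
  obtain ⟨k, l, _ | _⟩ := d
  · simp only [domino, unitSquare, Set.mem_prod, Set.mem_Icc, cond]
    constructor
    · rintro ⟨⟨h1, h2⟩, h3, h4⟩
      rcases le_total x (k + 1) with h | h
      · exact ⟨k, l, by simp [CellIn], ⟨h1, h⟩, h3, h4⟩
      · exact ⟨k + 1, l, by simp [CellIn], ⟨by push_cast; exact h, by push_cast; linarith⟩, h3, h4⟩
    · rintro ⟨i, j, hc, ⟨h1, h2⟩, h3, h4⟩
      rcases cellIn_iff.1 hc with h | h | h | h <;>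
        simp only [Prod.mk.injEq, Bool.false_eq_true, and_false] at h
      · obtain ⟨rfl, rfl, -⟩ := h
        exact ⟨⟨h1, by linarith⟩, h3, h4⟩
      · obtain ⟨rfl, rfl, -⟩ := h
        push_cast
        exact ⟨⟨by linarith, by linarith⟩, h3, h4⟩
  · simp only [domino, unitSquare, Set.mem_prod, Set.mem_Icc, cond]
    constructor
    · rintro ⟨⟨h1, h2⟩, h3, h4⟩
      rcases le_total y (l + 1) with h | h
      · exact ⟨k, l, by simp [CellIn], ⟨h1, h2⟩, h3, h⟩
      · exact ⟨k, l + 1, by simp [CellIn], ⟨h1, h2⟩, by push_cast; exact h, by push_cast; linarith⟩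
    · rintro ⟨i, j, hc, ⟨h1, h2⟩, h3, h4⟩
      rcases cellIn_iff.1 hc with h | h | h | h <;>
        simp only [Prod.mk.injEq, Bool.true_eq_false, and_false] at h
      · obtain ⟨rfl, rfl, -⟩ := h
        exact ⟨⟨h1, h2⟩, h3, by linarith⟩
      · obtain ⟨rfl, rfl, -⟩ := h
        push_cast
        exact ⟨⟨h1, h2⟩, by linarith, by linarith⟩

/-! ### Tilings as exact covers -/

/-- The number of selected dominoes that contain a given cell. -/
abbrev coverCount (τ : ℤ × ℤ × Bool → Bool) (i j : ℤ) : ℕ :=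
  (τ (i, j, false)).toNat + (τ (i - 1, j, false)).toNat + (τ (i, j, true)).toNat +
    (τ (i, j - 1, true)).toNat

/-- The selected dominoes cover each cell of `C` once and no other cell. -/
def ExactCover (C : Set (ℤ × ℤ)) (τ : ℤ × ℤ × Bool → Bool) : Prop :=
  ∀ i j, ((i, j) ∈ C → coverCount τ i j = 1) ∧ ((i, j) ∉ C → coverCount τ i j = 0)

theorem coverCount_pos_iff {τ : ℤ × ℤ × Bool → Bool} {i j : ℤ} :
    0 < coverCount τ i j ↔ ∃ d, τ d = true ∧ CellIn i j d := by
  simp only [cellIn_iff, coverCount]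
  constructor
  · intro h
    by_contra! H
    have h1 := H (i, j, false)
    have h2 := H (i - 1, j, false)
    have h3 := H (i, j, true)
    have h4 := H (i, j - 1, true)
    simp at h1 h2 h3 h4
    simp [h1, h2, h3, h4] at h
  · rintro ⟨d, hd, rfl | rfl | rfl | rfl⟩ <;> simp [hd]

theorem coverCount_le_one_iff {τ : ℤ × ℤ × Bool → Bool} {i j : ℤ} :
    coverCount τ i j ≤ 1 ↔
      ∀ d e, τ d = true → τ e = true → CellIn i j d → CellIn i j e → d = e := by
  simp only [cellIn_iff, coverCount]
  constructor
  · rintro h d e hd he (rfl | rfl | rfl | rfl) (rfl | rfl | rfl | rfl) <;>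
      first
      | rfl
      | (simp only [hd, he, Bool.toNat_true] at h; omega)
  · intro H
    have h1 := H (i, j, false) (i - 1, j, false)
    have h2 := H (i, j, false) (i, j, true)
    have h3 := H (i, j, false) (i, j - 1, true)
    have h4 := H (i - 1, j, false) (i, j, true)
    have h5 := H (i - 1, j, false) (i, j - 1, true)
    have h6 := H (i, j, true) (i, j - 1, true)
    simp [show i ≠ i - 1 by omega, show j ≠ j - 1 by omega] at h1 h2 h3 h4 h5 h6
    revert h1 h2 h3 h4 h5 h6
    generalize τ (i, j, false) = a
    generalize τ (i - 1, j, false) = b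
    generalize τ (i, j, true) = c
    generalize τ (i, j - 1, true) = d
    clear H
    revert a b c d
    decide

/-- The union of the unit squares of a set of cells. -/
def region (C : Set (ℤ × ℤ)) : Set (ℝ × ℝ) := ⋃ c ∈ C, unitSquare c.1 c.2

theorem center_mem_region {C : Set (ℤ × ℤ)} {i j : ℤ} : center i j ∈ region C ↔ (i, j) ∈ C := by
  simp [region, center_mem_unitSquare, ← and_assoc]

/-- Cell centres never lie on a domino's boundary, so they detect both the union and overlapping
interiors. Conversely, overlapping dominoes share a whole cell. -/
theorem isDominoTiling_image_iff {C : Set (ℤ × ℤ)} {τ : ℤ × ℤ × Bool → Bool} :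
    IsDominoTiling (region C) (domino '' {d | τ d = true}) ↔ ExactCover C τ := by
  constructor
  · rintro ⟨-, hdis, hU⟩ i j
    have hpos : 0 < coverCount τ i j ↔ (i, j) ∈ C := by
      rw [coverCount_pos_iff, ← center_mem_region, ← hU]
      simp [center_mem_domino]
    have hle : coverCount τ i j ≤ 1 := by
      rw [coverCount_le_one_iff]
      intro d e hd he hcd hce
      by_contra hne
      exact Set.disjoint_left.1 (hdis ⟨d, hd, rfl⟩ ⟨e, he, rfl⟩ (domino_injective.ne hne))
        (center_mem_interior_domino.2 hcd) (center_mem_interior_domino.2 hce)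
    refine ⟨fun h => ?_, fun h => ?_⟩
    · have := hpos.2 h
      omega
    · have := mt hpos.1 h
      omega
  · intro h
    have hpos {i j : ℤ} : 0 < coverCount τ i j ↔ (i, j) ∈ C := by
      by_cases hc : (i, j) ∈ C
      · simp only [hc, (h i j).1 hc, zero_lt_one]
      · simp only [hc, (h i j).2 hc, lt_irrefl]
    refine ⟨?_, ?_, ?_⟩
    · rintro _ ⟨d, -, rfl⟩
      exact isDomino_iff.2 ⟨d, rfl⟩
    · rintro _ ⟨d, hd, rfl⟩ _ ⟨e, he, rfl⟩ hne
      by_contra hn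
      obtain ⟨i, j, hi, hj⟩ := exists_cellIn_of_not_disjoint hn
      have hle : coverCount τ i j ≤ 1 := by
        by_cases hc : (i, j) ∈ C
        · exact ((h i j).1 hc).le
        · exact ((h i j).2 hc).le.trans zero_le_one
      exact hne (congrArg _ (coverCount_le_one_iff.1 hle d e hd he hi hj))
    · ext p
      simp only [Set.sUnion_image, Set.mem_iUnion, Set.mem_ofPred_eq, mem_domino_iff, region,
        exists_prop, Prod.exists]
      constructor
      · rintro ⟨k, l, o, hd, i, j, hc, hp⟩
        exact ⟨i, j, hpos.1 (coverCount_pos_iff.2 ⟨_, hd, hc⟩), hp⟩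
      · rintro ⟨i, j, hc, hp⟩
        obtain ⟨⟨k, l, o⟩, hd, hcd⟩ := coverCount_pos_iff.1 (hpos.2 hc)
        exact ⟨k, l, o, hd, i, j, hcd, hp⟩

theorem ncard_isDominoTiling (C : Set (ℤ × ℤ)) :
    {T | IsDominoTiling (region C) T}.ncard = {τ | ExactCover C τ}.ncard := by
  have hinj : Function.Injective
      fun τ : ℤ × ℤ × Bool → Bool => domino '' {d | τ d = true} := by
    intro τ υ h
    have := Set.image_injective.2 domino_injective h
    funext d
    have hd := Set.ext_iff.1 this d
    simp only [Set.mem_ofPred_eq] at hd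
    exact Bool.eq_iff_iff.2 hd
  rw [← Set.ncard_image_of_injective _ hinj]
  congr 1
  ext T
  simp only [Set.mem_ofPred_eq, Set.mem_image]
  constructor
  · intro hT
    classical
    have e : domino '' {d | decide (domino d ∈ T) = true} = T := by
      ext D
      simp only [decide_eq_true_eq, Set.mem_image, Set.mem_ofPred_eq]
      constructor
      · rintro ⟨d, hd, rfl⟩
        exact hd
      · intro hD
        obtain ⟨d, rfl⟩ := isDomino_iff.1 (hT.1 D hD)
        exact ⟨d, hD, rfl⟩
    exact ⟨fun d => decide (domino d ∈ T), isDominoTiling_image_iff.1 (e.symm ▸ hT), e⟩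
  · rintro ⟨τ, hτ, rfl⟩
    exact isDominoTiling_image_iff.2 hτ

/-- The cells of the Aztec diamond of order `n`. -/
def aztecCells (n : ℕ) : Set (ℤ × ℤ) :=
  {c | |c.1| + |c.2| ≤ n + 1 ∧ |c.1| + |c.2 + 1| ≤ n + 1 ∧ |c.1 + 1| + |c.2| ≤ n + 1 ∧
    |c.1 + 1| + |c.2 + 1| ≤ (n : ℤ) + 1}

theorem aztecDiamond_eq_region (n : ℕ) : aztecDiamond n = region (aztecCells n) := by
  ext p
  simp [aztecDiamond, region, aztecCells]
  grind

/-! ### Block states and the local weight identity -/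

/-- The state of a two-by-two block: which of its north, south, east and west dominoes are used. -/
abbrev BlockState := Bool × Bool × Bool × Bool

/-- Which of the north-east, south-west, north-west and south-east cells of a block are covered
by the dominoes of the block. -/
abbrev Coverage := Bool × Bool × Bool × Bool

namespace BlockState

abbrev north (q : BlockState) : Bool := q.1
abbrev south (q : BlockState) : Bool := q.2.1
abbrev east (q : BlockState) : Bool := q.2.2.1
abbrev west (q : BlockState) : Bool := q.2.2.2

/-- The state of a block none of whose dominoes is used. -/
abbrev empty : BlockState := (false, false, false, false)

/-- The dominoes used in the block do not overlap. -/
def Valid (q : BlockState) : Prop :=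
  (q.north && q.east) = false ∧ (q.south && q.west) = false ∧
    (q.north && q.west) = false ∧ (q.south && q.east) = false

instance : DecidablePred Valid := fun _ => inferInstanceAs (Decidable (_ ∧ _))

/-- The cells covered by the dominoes of a block. -/
abbrev coverage (q : BlockState) : Coverage :=
  (q.north || q.east, q.south || q.west, q.north || q.west, q.south || q.east)

end BlockState

namespace Coverage

abbrev ne (t : Coverage) : Bool := t.1
abbrev sw (t : Coverage) : Bool := t.2.1
abbrev nw (t : Coverage) : Bool := t.2.2.1
abbrev se (t : Coverage) : Bool := t.2.2.2

/-- The complementary set of cells. -/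
abbrev compl (t : Coverage) : Coverage := (!t.ne, !t.sw, !t.nw, !t.se)

/-- The number of ways to cover exactly the given cells of a block by dominoes of the block. -/
def weight (t : Coverage) : ℕ :=
  (Finset.univ.filter fun q : BlockState => q.Valid ∧ q.coverage = t).card

/-- The local identity behind the recursion: full reads 2·2 = 4·1, empty 2·1 = 1·2, and two adjacent
cells, of which exactly one is NE or SW, 2·1 = 2·1. For all other coverages both sides vanish. -/
theorem two_mul_weight (t : Coverage) :
    2 * t.weight = 2 ^ (t.ne.toNat + t.sw.toNat) * t.compl.weight := by
  revert t; decide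

theorem compl_compl (t : Coverage) : t.compl.compl = t := by
  revert t; decide

end Coverage

/-- Functions whose values are constrained pointwise and whose composite with `r` is constrained
globally, counted along the fibres of `r`. -/
theorem card_filter_comp_eq_sum_prod {ι Q R : Type*} [Fintype ι] [DecidableEq ι] [Fintype Q]
    [Fintype R] [DecidableEq R] (r : Q → R) (V : Q → Prop) [DecidablePred V]
    (P : (ι → R) → Prop) [DecidablePred P] :
    (Finset.univ.filter fun s : ι → Q => (∀ i, V (s i)) ∧ P (r ∘ s)).card =
      ∑ t with P t, ∏ i, (Finset.univ.filter fun q => V q ∧ r q = t i).card := by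
  rw [Finset.card_eq_sum_card_fiberwise (f := fun s => r ∘ s)
    (t := Finset.univ.filter fun t => P t) (by intro s hs; simp at hs ⊢; exact hs.2)]
  refine Finset.sum_congr rfl fun t ht => ?_
  rw [← Fintype.card_piFinset]
  congr 1
  ext s
  simp only [Finset.mem_filter, Finset.mem_univ, true_and, Fintype.mem_piFinset] at ht ⊢
  constructor
  · rintro ⟨⟨h, -⟩, rfl⟩ i
    exact ⟨h i, rfl⟩
  · intro h
    have e : r ∘ s = t := funext fun i => (h i).2
    exact ⟨⟨fun i => (h i).1, e ▸ ht⟩, e⟩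

/-! ### Grids of blocks -/

/-- A cell between two adjacent blocks of the grid is covered by exactly one of them, and a cell
on the border of the grid is covered if and only if `bd` holds. -/
def Compatible (n : ℕ) (bd : Bool) (t : Fin (n + 1) × Fin (n + 1) → Coverage) : Prop :=
  (∀ b, (t (0, b)).sw = bd ∧ (t (Fin.last n, b)).ne = bd ∧
    ∀ i : Fin n, (t (i.castSucc, b)).ne = !(t (i.succ, b)).sw) ∧
  (∀ a, (t (a, 0)).se = bd ∧ (t (a, Fin.last n)).nw = bd ∧
    ∀ i : Fin n, (t (a, i.castSucc)).nw = !(t (a, i.succ)).se)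

instance (n : ℕ) (bd : Bool) : DecidablePred (Compatible n bd) :=
  fun _ => inferInstanceAs (Decidable (_ ∧ _))

/-- The number of compatible grids of valid block states. -/
def gridCount (n : ℕ) (bd : Bool) : ℕ :=
  (Finset.univ.filter fun s : Fin (n + 1) × Fin (n + 1) → BlockState =>
    (∀ i, (s i).Valid) ∧ Compatible n bd (BlockState.coverage ∘ s)).card

theorem gridCount_eq (n : ℕ) (bd : Bool) :
    gridCount n bd = ∑ t with Compatible n bd t, ∏ i, (t i).weight :=
  card_filter_comp_eq_sum_prod _ _ _

/-- Each of the n + 1 lines in the NE direction contributes n shared cells, counted once each, and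
two covered border cells. -/
theorem Compatible.sum_eq {n : ℕ} {t : Fin (n + 1) × Fin (n + 1) → Coverage}
    (h : Compatible n true t) :
    ∑ i, ((t i).ne.toNat + (t i).sw.toNat) = (n + 1) * (n + 1) + (n + 1) := by
  rw [Fintype.sum_prod_type_right]
  have key : ∀ b, ∑ a, ((t (a, b)).ne.toNat + (t (a, b)).sw.toNat) = n + 2 := by
    intro b
    obtain ⟨h0, h1, h2⟩ := h.1 b
    rw [Finset.sum_add_distrib, Fin.sum_univ_castSucc, Fin.sum_univ_succ (n := n), h0, h1]
    have : ∑ i : Fin n, (t (i.castSucc, b)).ne.toNat + ∑ i : Fin n, (t (i.succ, b)).sw.toNat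
        = n := by
      rw [← Finset.sum_add_distrib, Finset.sum_congr rfl (g := fun _ => 1), Finset.sum_const]
      · simp
      · intro i _
        rw [h2 i]
        cases (t (i.succ, b)).sw <;> rfl
    simp only [Bool.toNat_true]
    omega
  simp only [key, Finset.sum_const, Finset.card_univ, Fintype.card_fin, smul_eq_mul]
  ring

/-- "Covered from exactly one side" is symmetric under negation; only the border condition flips. -/
theorem compatible_compl {n : ℕ} {bd : Bool} {t : Fin (n + 1) × Fin (n + 1) → Coverage}
    (h : Compatible n bd t) : Compatible n (!bd) (fun i => (t i).compl) := by
  refine ⟨fun b => ?_, fun a => ?_⟩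
  · obtain ⟨h0, h1, h2⟩ := h.1 b
    exact ⟨congrArg not h0, congrArg not h1, fun i => congrArg not (h2 i)⟩
  · obtain ⟨h0, h1, h2⟩ := h.2 a
    exact ⟨congrArg not h0, congrArg not h1, fun i => congrArg not (h2 i)⟩

theorem gridCount_true (n : ℕ) : gridCount n true = 2 ^ (n + 1) * gridCount n false := by
  have hc (t : Fin (n + 1) × Fin (n + 1) → Coverage) : (fun i => ((t i).compl).compl) = t :=
    funext fun i => (t i).compl_compl
  rw [gridCount_eq, gridCount_eq, Finset.mul_sum]
  refine Finset.sum_bij' (fun t _ i => (t i).compl) (fun t _ i => (t i).compl) ?_ ?_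
    (fun t _ => hc t) (fun t _ => hc t) ?_
  · intro t ht
    exact Finset.mem_filter.2 ⟨Finset.mem_univ _, compatible_compl (Finset.mem_filter.1 ht).2⟩
  · intro t ht
    exact Finset.mem_filter.2 ⟨Finset.mem_univ _, compatible_compl (Finset.mem_filter.1 ht).2⟩
  · intro t ht
    have hs := Compatible.sum_eq (Finset.mem_filter.1 ht).2
    have h : ∏ i, 2 * (t i).weight =
        ∏ i, 2 ^ ((t i).ne.toNat + (t i).sw.toNat) * (t i).compl.weight :=
      Finset.prod_congr rfl fun i _ => (t i).two_mul_weight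
    rw [Finset.prod_mul_distrib, Finset.prod_mul_distrib, Finset.prod_pow_eq_pow_sum, hs,
      Finset.prod_const, Finset.card_univ, Fintype.card_prod, Fintype.card_fin, pow_add,
      mul_assoc] at h
    -- The factor cancelled is one 2 per block, 2^((n+1)(n+1)); the excess 2^(n+1) remains.
    exact Nat.eq_of_mul_eq_mul_left (by positivity) h

theorem gridCount_zero_false : gridCount 0 false = 1 := by
  decide

/-! ### Tilings as grids of blocks -/

/-- The block states of a selection of dominoes; the block `(a, b)` has centre
`(a - b, a + b - m)`. -/
def toBlocks (m : ℤ) (τ : ℤ × ℤ × Bool → Bool) (p : ℤ × ℤ) : BlockState :=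
  (τ (p.1 - p.2 - 1, p.1 + p.2 - m, false), τ (p.1 - p.2 - 1, p.1 + p.2 - m - 1, false),
    τ (p.1 - p.2, p.1 + p.2 - m - 1, true), τ (p.1 - p.2 - 1, p.1 + p.2 - m - 1, true))

/-- The selection of dominoes with the given block states. -/
def ofBlocks (m : ℤ) (σ : ℤ × ℤ → BlockState) (d : ℤ × ℤ × Bool) : Bool :=
  -- Parity of the lower left corner separates south and west dominoes (even) from north and east
  -- ones (odd).
  if (d.1 + d.2.1 + m) % 2 = 0 then
    cond d.2.2 (σ ((d.1 + d.2.1 + m + 2) / 2, (d.2.1 + m - d.1) / 2)).west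
      (σ ((d.1 + d.2.1 + m + 2) / 2, (d.2.1 + m - d.1) / 2)).south
  else
    cond d.2.2 (σ ((d.1 + d.2.1 + m + 1) / 2, (d.2.1 + m - d.1 + 1) / 2)).east
      (σ ((d.1 + d.2.1 + m + 1) / 2, (d.2.1 + m - d.1 - 1) / 2)).north

theorem ofBlocks_toBlocks (m : ℤ) (τ : ℤ × ℤ × Bool → Bool) : ofBlocks m (toBlocks m τ) = τ := by
  funext ⟨i, j, o⟩
  cases o <;> simp only [ofBlocks, toBlocks, cond] <;> split_ifs <;> grind

theorem toBlocks_ofBlocks (m : ℤ) (σ : ℤ × ℤ → BlockState) : toBlocks m (ofBlocks m σ) = σ := by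
  funext ⟨a, b⟩
  have h0 : ¬ (a - b - 1 + (a + b - m) + m) % 2 = 0 := by omega
  have h1 : (a - b - 1 + (a + b - m - 1) + m) % 2 = 0 := by omega
  have h2 : ¬ (a - b + (a + b - m - 1) + m) % 2 = 0 := by omega
  simp only [ofBlocks, toBlocks, cond, h0, h1, h2, if_true, if_false]
  have e1 : ((a - b - 1 + (a + b - m) + m + 1) / 2, (a + b - m + m - (a - b - 1) - 1) / 2)
      = (a, b) := by ext <;> simp only <;> omega
  have e2 : ((a - b - 1 + (a + b - m - 1) + m + 2) / 2, (a + b - m - 1 + m - (a - b - 1)) / 2)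
      = (a, b) := by ext <;> simp only <;> omega
  have e3 : ((a - b + (a + b - m - 1) + m + 1) / 2, (a + b - m - 1 + m - (a - b) + 1) / 2)
      = (a, b) := by ext <;> simp only <;> omega
  rw [e1, e2, e3]

/-- Selections of dominoes and families of block states are the same. -/
def blocksEquiv (m : ℤ) : (ℤ × ℤ × Bool → Bool) ≃ (ℤ × ℤ → BlockState) where
  toFun := toBlocks m
  invFun := ofBlocks m
  left_inv := ofBlocks_toBlocks m
  right_inv := toBlocks_ofBlocks m

namespace BlockState

/-- How many used dominoes of the block contain its north-east cell. -/
def neCount (q : BlockState) : ℕ := q.north.toNat + q.east.toNat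
/-- How many used dominoes of the block contain its south-west cell. -/
def swCount (q : BlockState) : ℕ := q.south.toNat + q.west.toNat
/-- How many used dominoes of the block contain its north-west cell. -/
def nwCount (q : BlockState) : ℕ := q.north.toNat + q.west.toNat
/-- How many used dominoes of the block contain its south-east cell. -/
def seCount (q : BlockState) : ℕ := q.south.toNat + q.east.toNat

theorem valid_iff (q : BlockState) : q.Valid ↔
    q.neCount ≤ 1 ∧ q.swCount ≤ 1 ∧ q.nwCount ≤ 1 ∧ q.seCount ≤ 1 := by
  revert q; decide

theorem eq_empty_of_ne_sw (q : BlockState) : q.neCount = 0 → q.swCount = 0 → q = empty := by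
  revert q; decide

theorem eq_empty_of_nw_se (q : BlockState) : q.nwCount = 0 → q.seCount = 0 → q = empty := by
  revert q; decide

theorem Valid.counts {q : BlockState} : q.Valid →
    q.neCount = q.coverage.ne.toNat ∧ q.swCount = q.coverage.sw.toNat ∧
      q.nwCount = q.coverage.nw.toNat ∧ q.seCount = q.coverage.se.toNat := by
  revert q; decide

end BlockState

/-- A sequence of cells is covered once at the positions in `I` and not at all elsewhere; the
cell at position `a` is covered `x a` times from the left and `y (a + 1)` times from the right. -/
def CoversOnce (I : ℤ → Prop) (x y : ℤ → ℕ) : Prop :=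
  ∀ a, (I a → x a + y (a + 1) = 1) ∧ (¬ I a → x a + y (a + 1) = 0)

/-- The `n` positions between the `n + 1` integers from `0` to `n`, together with the two outer
ones if `bd` holds. -/
def InLine (n : ℕ) (bd : Bool) (a : ℤ) : Prop :=
  (0 ≤ a ∧ a < n) ∨ bd = true ∧ (a = -1 ∨ a = n)

theorem coversOnce_iff {n : ℕ} {bd : Bool} {x y : ℤ → ℕ}
    (hx : ∀ a : ℤ, ¬ (0 ≤ a ∧ a ≤ n) → x a = 0) (hy : ∀ a : ℤ, ¬ (0 ≤ a ∧ a ≤ n) → y a = 0) :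
    CoversOnce (InLine n bd) x y ↔
      y 0 = bd.toNat ∧ x n = bd.toNat ∧ ∀ i : Fin n, x (i : ℕ) + y ((i : ℕ) + 1) = 1 := by
  -- The outer positions -1 and n are reached from one side only, so their conditions concern just
  -- `y 0` and `x n`.
  have hx' := hx (-1) (by omega)
  have hy' := hy (n + 1) (by omega)
  constructor
  · intro h
    have h0 := h (-1)
    have h1 := h n
    refine ⟨?_, ?_, fun i => (h i).1 (Or.inl ⟨by omega, by have := i.2; omega⟩)⟩
    · cases bd <;> simp [InLine, hx'] at h0 ⊢ <;> omega
    · cases bd <;> simp [InLine, hy'] at h1 ⊢ <;> omega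
  · rintro ⟨h0, h1, h2⟩ a
    by_cases ha : 0 ≤ a ∧ a < n
    · obtain ⟨k, rfl⟩ := Int.eq_ofNat_of_zero_le ha.1
      exact ⟨fun _ => h2 ⟨k, by omega⟩, fun h => absurd (Or.inl ha) h⟩
    · by_cases h3 : a = -1
      · subst h3
        cases bd <;> simp [InLine, hx'] <;> simpa using h0
      · by_cases h4 : a = n
        · subst h4
          cases bd <;> simp [InLine, hy'] <;> simpa using h1
        · refine ⟨fun h => ?_, fun _ => ?_⟩
          · rcases h with h | ⟨-, h⟩ <;> omega
          · rw [hx a (by omega), hy (a + 1) (by omega)]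

theorem CoversOnce.le_one {I : ℤ → Prop} {x y : ℤ → ℕ} (h : CoversOnce I x y) (a : ℤ) :
    x a ≤ 1 ∧ y a ≤ 1 := by
  have h1 := h a
  have h2 := h (a - 1)
  rw [sub_add_cancel] at h2
  by_cases c1 : I a <;> by_cases c2 : I (a - 1) <;> simp only [c1, c2] at h1 h2 <;> grind

/-- In all the rows and columns of blocks, exactly the cells of the grid are covered, and they are
covered once. -/
def BlockCover (n : ℕ) (bd : Bool) (σ : ℤ × ℤ → BlockState) : Prop :=
  (∀ b : ℤ, CoversOnce (fun a => (0 ≤ b ∧ b ≤ n) ∧ InLine n bd a)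
    (fun a => (σ (a, b)).neCount) (fun a => (σ (a, b)).swCount)) ∧
  (∀ a : ℤ, CoversOnce (fun b => (0 ≤ a ∧ a ≤ n) ∧ InLine n bd b)
    (fun b => (σ (a, b)).nwCount) (fun b => (σ (a, b)).seCount))

/-- The NE cell of block (a, b) is the SW cell of (a + 1, b), and its NW cell is the SE cell of (a,
b + 1). By parity every cell is of one of these two kinds. -/
theorem exactCover_iff {n : ℕ} {bd : Bool} {C : Set (ℤ × ℤ)}
    (h₁ : ∀ a b : ℤ, (a - b, a + b - n) ∈ C ↔ (0 ≤ b ∧ b ≤ n) ∧ InLine n bd a)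
    (h₂ : ∀ a b : ℤ, (a - b - 1, a + b - n) ∈ C ↔ (0 ≤ a ∧ a ≤ n) ∧ InLine n bd b)
    (τ : ℤ × ℤ × Bool → Bool) : ExactCover C τ ↔ BlockCover n bd (toBlocks n τ) := by
  have e₁ (a b : ℤ) : coverCount τ (a - b) (a + b - n) =
      (toBlocks n τ (a, b)).neCount + (toBlocks n τ (a + 1, b)).swCount := by
    simp only [coverCount, toBlocks, BlockState.neCount, BlockState.swCount]
    rw [show a + 1 - b - 1 = a - b by ring, show a + 1 + b - n - 1 = a + b - n by ring]
    ring
  have e₂ (a b : ℤ) : coverCount τ (a - b - 1) (a + b - n) =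
      (toBlocks n τ (a, b)).nwCount + (toBlocks n τ (a, b + 1)).seCount := by
    simp only [coverCount, toBlocks, BlockState.nwCount, BlockState.seCount]
    rw [show a - (b + 1) - 1 = a - b - 1 - 1 by ring, show a + (b + 1) - n - 1 = a + b - n by ring,
      show a - (b + 1) = a - b - 1 by ring]
    ring
  constructor
  · intro h
    refine ⟨fun b a => ?_, fun a b => ?_⟩
    · have := h (a - b) (a + b - n)
      rwa [e₁, h₁] at this
    · have := h (a - b - 1) (a + b - n)
      rwa [e₂, h₂] at this
  · intro h i j
    obtain ⟨a, b, ⟨rfl, rfl⟩ | ⟨rfl, rfl⟩⟩ : ∃ a b : ℤ,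
        (i = a - b ∧ j = a + b - n) ∨ (i = a - b - 1 ∧ j = a + b - n) := by
      rcases Int.emod_two_eq_zero_or_one (i + j + n) with h | h
      · exact ⟨(i + j + n) / 2, (j + n - i) / 2, Or.inl (by omega)⟩
      · exact ⟨(i + j + n + 1) / 2, (j + n - i - 1) / 2, Or.inr (by omega)⟩
    · rw [e₁, h₁]
      exact h.1 b a
    · rw [e₂, h₂]
      exact h.2 a b

/-- The extension of a finite grid of block states by empty blocks. -/
def extend {n : ℕ} (s : Fin (n + 1) × Fin (n + 1) → BlockState) (p : ℤ × ℤ) : BlockState :=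
  if h : (0 ≤ p.1 ∧ p.1 ≤ n) ∧ (0 ≤ p.2 ∧ p.2 ≤ n) then
    s (⟨p.1.toNat, by omega⟩, ⟨p.2.toNat, by omega⟩) else BlockState.empty

theorem extend_coe {n : ℕ} (s : Fin (n + 1) × Fin (n + 1) → BlockState) (i j : Fin (n + 1)) :
    extend s (((i : ℕ) : ℤ), ((j : ℕ) : ℤ)) = s (i, j) := by
  have := i.2
  have := j.2
  rw [extend, dif_pos (by simp only; omega)]
  simp

theorem extend_of_not {n : ℕ} (s : Fin (n + 1) × Fin (n + 1) → BlockState) {a b : ℤ}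
    (h : ¬ ((0 ≤ a ∧ a ≤ n) ∧ (0 ≤ b ∧ b ≤ n))) : extend s (a, b) = BlockState.empty :=
  dif_neg h

theorem extend_injective {n : ℕ} : Function.Injective (extend (n := n)) := by
  intro s s' h
  funext ⟨i, j⟩
  rw [← extend_coe s, h, extend_coe]

/-- Outside the grid, two opposite cells of the block are uncovered, and every domino of the block
contains one of them. -/
theorem BlockCover.eq_empty {n : ℕ} {bd : Bool} {σ : ℤ × ℤ → BlockState}
    (h : BlockCover n bd σ) {a b : ℤ} (hab : ¬ ((0 ≤ a ∧ a ≤ n) ∧ (0 ≤ b ∧ b ≤ n))) :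
    σ (a, b) = BlockState.empty := by
  by_cases ha : 0 ≤ a ∧ a ≤ n
  · have hb : ¬ (0 ≤ b ∧ b ≤ n) := fun hb => hab ⟨ha, hb⟩
    have h1 := (h.1 b a).2 fun H => hb H.1
    have h2 := (h.1 b (a - 1)).2 fun H => hb H.1
    rw [sub_add_cancel] at h2
    exact BlockState.eq_empty_of_ne_sw _ (Nat.add_eq_zero_iff.1 h1).1 (Nat.add_eq_zero_iff.1 h2).2
  · have h1 := (h.2 a b).2 fun H => ha H.1
    have h2 := (h.2 a (b - 1)).2 fun H => ha H.1
    rw [sub_add_cancel] at h2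
    exact BlockState.eq_empty_of_nw_se _ (Nat.add_eq_zero_iff.1 h1).1 (Nat.add_eq_zero_iff.1 h2).2

theorem BlockCover.exists_extend {n : ℕ} {bd : Bool} {σ : ℤ × ℤ → BlockState}
    (h : BlockCover n bd σ) : ∃ s, extend (n := n) s = σ := by
  refine ⟨fun p => σ (((p.1 : ℕ) : ℤ), ((p.2 : ℕ) : ℤ)), ?_⟩
  funext ⟨a, b⟩
  by_cases hab : (0 ≤ a ∧ a ≤ n) ∧ (0 ≤ b ∧ b ≤ n)
  · rw [extend, dif_pos hab]
    simp [hab.1.1, hab.2.1]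
  · rw [extend_of_not _ hab, h.eq_empty hab]

theorem BlockCover.valid {n : ℕ} {bd : Bool} {σ : ℤ × ℤ → BlockState}
    (h : BlockCover n bd σ) (p : ℤ × ℤ) : (σ p).Valid := by
  have h1 := (h.1 p.2).le_one p.1
  have h2 := (h.2 p.1).le_one p.2
  exact (BlockState.valid_iff _).2 ⟨h1.1, h1.2, h2.1, h2.2⟩

theorem coversOnce_line_iff {n : ℕ} {bd : Bool} {x y : ℤ → ℕ} {u v : Fin (n + 1) → Bool}
    (hx : ∀ a : ℤ, ¬ (0 ≤ a ∧ a ≤ n) → x a = 0) (hy : ∀ a : ℤ, ¬ (0 ≤ a ∧ a ≤ n) → y a = 0)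
    (hu : ∀ i : Fin (n + 1), x (i : ℕ) = (u i).toNat)
    (hv : ∀ i : Fin (n + 1), y (i : ℕ) = (v i).toNat) :
    CoversOnce (InLine n bd) x y ↔
      v 0 = bd ∧ u (Fin.last n) = bd ∧ ∀ i : Fin n, u i.castSucc = !v i.succ := by
  have hB : ∀ p q : Bool, p.toNat + q.toNat = 1 ↔ p = !q := by decide
  have hB' : ∀ p q : Bool, p.toNat = q.toNat ↔ p = q := by decide
  have h0 := hv 0
  have h1 := hu (Fin.last n)
  simp only [Fin.val_zero, Nat.cast_zero, Fin.val_last] at h0 h1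
  rw [coversOnce_iff hx hy, h0, h1, hB', hB']
  refine and_congr_right fun _ => and_congr_right fun _ => forall_congr' fun i => ?_
  have h2 := hu i.castSucc
  have h3 := hv i.succ
  simp only [Fin.val_castSucc, Fin.val_succ, Nat.cast_add, Nat.cast_one] at h2 h3
  rw [h2, h3, hB]

theorem blockCover_extend_iff {n : ℕ} {bd : Bool}
    (s : Fin (n + 1) × Fin (n + 1) → BlockState) :
    BlockCover n bd (extend s) ↔
      (∀ i, (s i).Valid) ∧ Compatible n bd (BlockState.coverage ∘ s) := by
  -- Validity makes the numerical counts agree with the Boolean coverage.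
  suffices H : (∀ i, (s i).Valid) →
      (BlockCover n bd (extend s) ↔ Compatible n bd (BlockState.coverage ∘ s)) by
    refine ⟨fun h => ?_, fun h => (H h.1).2 h.2⟩
    have hv : ∀ i, (s i).Valid := fun i => extend_coe s i.1 i.2 ▸ h.valid _
    exact ⟨hv, (H hv).1 h⟩
  intro hv
  have row (b : Fin (n + 1)) := coversOnce_line_iff (n := n) (bd := bd)
    (x := fun a => (extend s (a, ((b : ℕ) : ℤ))).neCount)
    (y := fun a => (extend s (a, ((b : ℕ) : ℤ))).swCount)
    (u := fun a => (s (a, b)).coverage.ne) (v := fun a => (s (a, b)).coverage.sw)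
    (fun a ha => by simp only [extend_of_not s fun h => ha h.1]; rfl)
    (fun a ha => by simp only [extend_of_not s fun h => ha h.1]; rfl)
    (fun a => by simp only [extend_coe]; exact (hv _).counts.1)
    (fun a => by simp only [extend_coe]; exact (hv _).counts.2.1)
  have col (a : Fin (n + 1)) := coversOnce_line_iff (n := n) (bd := bd)
    (x := fun b => (extend s (((a : ℕ) : ℤ), b)).nwCount)
    (y := fun b => (extend s (((a : ℕ) : ℤ), b)).seCount)
    (u := fun b => (s (a, b)).coverage.nw) (v := fun b => (s (a, b)).coverage.se)
    (fun b hb => by simp only [extend_of_not s fun h => hb h.2]; rfl)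
    (fun b hb => by simp only [extend_of_not s fun h => hb h.2]; rfl)
    (fun b => by simp only [extend_coe]; exact (hv _).counts.2.2.1)
    (fun b => by simp only [extend_coe]; exact (hv _).counts.2.2.2)
  have hin (b : Fin (n + 1)) : 0 ≤ ((b : ℕ) : ℤ) ∧ ((b : ℕ) : ℤ) ≤ n := by
    have := b.2
    omega
  constructor
  · intro h
    refine ⟨fun b => (row b).1 ?_, fun a => (col a).1 ?_⟩
    · simpa only [hin b, true_and, and_self] using h.1 (b : ℕ)
    · simpa only [hin a, true_and, and_self] using h.2 (a : ℕ)
  · intro h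
    refine ⟨fun b => ?_, fun a => ?_⟩
    · by_cases hb : 0 ≤ b ∧ b ≤ n
      · obtain ⟨k, rfl⟩ := Int.eq_ofNat_of_zero_le hb.1
        simpa only [hb, true_and, and_self] using (row ⟨k, by omega⟩).2 (h.1 _)
      · intro a
        refine ⟨fun H => absurd H.1 hb, fun _ => ?_⟩
        simp only [extend_of_not s fun H => hb H.2]
        rfl
    · by_cases ha : 0 ≤ a ∧ a ≤ n
      · obtain ⟨k, rfl⟩ := Int.eq_ofNat_of_zero_le ha.1
        simpa only [ha, true_and, and_self] using (col ⟨k, by omega⟩).2 (h.2 _)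
      · intro b
        refine ⟨fun H => absurd H.1 ha, fun _ => ?_⟩
        simp only [extend_of_not s fun H => ha H.1]
        rfl

theorem ncard_blockCover (n : ℕ) (bd : Bool) : {σ | BlockCover n bd σ}.ncard = gridCount n bd := by
  rw [gridCount, ← Set.ncard_coe_finset, ← Set.ncard_image_of_injective _ extend_injective]
  congr 1
  ext σ
  simp only [Set.mem_ofPred_eq, Set.mem_image, Finset.coe_filter, Finset.mem_univ, true_and]
  constructor
  · intro h
    obtain ⟨s, rfl⟩ := h.exists_extend
    exact ⟨s, (blockCover_extend_iff s).1 h, rfl⟩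
  · rintro ⟨s, hs, rfl⟩
    exact (blockCover_extend_iff s).2 hs

theorem ncard_exactCover {n : ℕ} {bd : Bool} {C : Set (ℤ × ℤ)}
    (h₁ : ∀ a b : ℤ, (a - b, a + b - n) ∈ C ↔ (0 ≤ b ∧ b ≤ n) ∧ InLine n bd a)
    (h₂ : ∀ a b : ℤ, (a - b - 1, a + b - n) ∈ C ↔ (0 ≤ a ∧ a ≤ n) ∧ InLine n bd b) :
    {τ | ExactCover C τ}.ncard = gridCount n bd := by
  rw [← ncard_blockCover, ← Set.ncard_image_of_injective _ (blocksEquiv n).injective]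
  congr 1
  ext σ
  simp only [Set.mem_ofPred_eq, Set.mem_image]
  constructor
  · rintro ⟨τ, hτ, rfl⟩
    exact (exactCover_iff h₁ h₂ τ).1 hτ
  · intro h
    refine ⟨(blocksEquiv n).symm σ, (exactCover_iff h₁ h₂ _).2 ?_,
      (blocksEquiv n).apply_symm_apply σ⟩
    rwa [show toBlocks n ((blocksEquiv n).symm σ) = σ from (blocksEquiv n).apply_symm_apply σ]

/-! ### Counting the tilings -/

theorem abs_add_abs_le_iff {x y k : ℤ} :
    |x| + |y| ≤ k ↔ x + y ≤ k ∧ x - y ≤ k ∧ -x + y ≤ k ∧ -x - y ≤ k := by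
  rcases abs_cases x with h | h <;> rcases abs_cases y with h' | h' <;> omega

theorem ncard_tilings_eq_gridCount_false (n : ℕ) :
    {T | IsDominoTiling (aztecDiamond n) T}.ncard = gridCount n false := by
  rw [aztecDiamond_eq_region, ncard_isDominoTiling]
  apply ncard_exactCover <;> intro a b <;>
    simp only [aztecCells, InLine, Set.mem_ofPred_eq, abs_add_abs_le_iff, Bool.false_eq_true,
      false_and, or_false] <;>
    omega

/-- The grid is the one used for order n; requiring its border cells to be covered raises the order
by one. -/
theorem ncard_tilings_succ_eq_gridCount_true (n : ℕ) :
    {T | IsDominoTiling (aztecDiamond (n + 1)) T}.ncard = gridCount n true := by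
  rw [aztecDiamond_eq_region, ncard_isDominoTiling]
  apply ncard_exactCover <;> intro a b <;>
    simp only [aztecCells, InLine, Set.mem_ofPred_eq, abs_add_abs_le_iff, true_and,
      Nat.cast_add, Nat.cast_one] <;>
    omega

end Aztec

theorem mainTheorem1 (n : ℕ) :
    {T : Set (Set (ℝ × ℝ)) | Aztec.IsDominoTiling (Aztec.aztecDiamond n) T}.ncard =
      2 ^ (n * (n + 1) / 2) := by
  induction n with
  | zero => rw [Aztec.ncard_tilings_eq_gridCount_false, Aztec.gridCount_zero_false]; rfl
  | succ n ih =>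
    rw [Aztec.ncard_tilings_succ_eq_gridCount_true, Aztec.gridCount_true,
      ← Aztec.ncard_tilings_eq_gridCount_false, ih, ← pow_add]
    congr 1
    rw [show (n + 1) * (n + 1 + 1) = n * (n + 1) + (n + 1) * 2 by ring,
      Nat.add_mul_div_right _ _ two_pos, add_comm]
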